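/- Let $b>1$ be an integer and let $A\subset\{0,1,\dots,b-1\}$ be a set of digits containing at least one non-zero digit; put $N=\#A$. Call a non-negative integer $n$ admissible if all digits of its minimal $b$-ary representation belong to $A$, and let $\ell(n)$ be the number of digits of that representation (so $\ell(0)=0$). The Dirichlet series $K(s)=\sum n^{-s}$, where the sum runs over all admissible integers $n>0$, converges absolutely for $\Re s>\log_b N$ and extends to a meromorphic function, still denoted $K$, on the whole complex plane. For every $k\in\mathbb Z$, put $$s_{0,k}=\log_b N+\frac{2\pi i k}{\log b}.$$ Then the limit below exists and the residue of $K$ at $s_{0,k}$ (understood as $0$ if $K$ has no pole there) is $$\operatorname{Res}_{s=s_{0,k}}K(s)=\frac1{\log b}\,\lim_{\ell\to\infty}\ \sum_{\substack{n\text{ admissible}\\ \ell(n)=\ell}}\frac1{n^{s_{0,k}}}.$$ -/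

import Mathlib

open Filter Topology

namespace RestrictedDirichlet

/-- All digits of the minimal `b`-ary representation of `n` belong to `A`. -/
def Admissible (b : ℕ) (A : Finset ℕ) (n : ℕ) : Prop :=
  ∀ d ∈ Nat.digits b n, d ∈ A

/-- The number of digits of the minimal `b`-ary representation of `n` (so `0` has length `0`). -/
def len (b n : ℕ) : ℕ := (Nat.digits b n).length

open Classical in
/-- The finite set of admissible integers of length `l`. -/
noncomputable def block (b : ℕ) (A : Finset ℕ) (l : ℕ) : Finset ℕ :=
  (Finset.range (b ^ l)).filter fun n => len b n = l ∧ Admissible b A n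

/-- For `b > 1` the bound `n < b ^ l` in the definition of `block` excludes nothing. -/
theorem mem_block {b : ℕ} (hb : 1 < b) (A : Finset ℕ) (l n : ℕ) :
    n ∈ block b A l ↔ len b n = l ∧ Admissible b A n := by
  classical
  unfold block
  rw [Finset.mem_filter, Finset.mem_range]
  refine ⟨fun h => h.2, fun h => ⟨?_, h⟩⟩
  rw [← h.1]
  exact Nat.lt_base_pow_length_digits hb

/-- `f` is a meromorphic function on the whole complex plane which is, on the half-plane
`Re s > log_b N` with `N = #A`, the sum of the series of `n ^ (-s)` over all positive admissible
integers `n`. -/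
def IsMeromorphicContinuation (b : ℕ) (A : Finset ℕ) (f : ℂ → ℂ) : Prop :=
  Meromorphic f ∧
    ∀ s : ℂ, Real.logb b A.card < s.re →
      HasSum (fun n : {n : ℕ // 0 < n ∧ Admissible b A n} => ((n : ℕ) : ℂ) ^ (-s)) (f s)

/-- `c` is the residue at `z` of the function `f`, meromorphic at `z`: the integral of `f` over
every sufficiently small positively oriented circle centred at `z` is `2πi c`. -/
def HasResidueAt (f : ℂ → ℂ) (z c : ℂ) : Prop :=
  MeromorphicAt f z ∧
    ∀ᶠ r : ℝ in 𝓝[>] 0, (∮ w in C(z, r), f w) = 2 * Real.pi * Complex.I * c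

/-- The point `log_b N + 2πik / log b` with `N = #A`. -/
noncomputable def poleZero (b : ℕ) (A : Finset ℕ) (k : ℤ) : ℂ :=
  (Real.logb b A.card : ℂ) + 2 * Real.pi * Complex.I * k / (Real.log b : ℂ)

end RestrictedDirichlet

/-!
The admissible integers of length `l + 2` are the `a + b m` with `a ∈ A` and `m` admissible of
length `l + 1`. Replacing `(a + b m) ^ (-s)` by `(b m) ^ (-s)` gives, with `N = #A`,

  `B_{l+2}(s) = N b ^ (-s) B_{l+1}(s) + E_l(s)`

for the block sums `B_l(s) = ∑ n ^ (-s)` over the admissible `n` of length `l`. Expanding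
`(1 + a / (b m)) ^ (-s)` in powers of `1 / m` shows that `∑ E_l(s)` converges already for
`Re s > log_b N - 1`, to `b ^ (-s) ∑_j c_j(s) K(s + 1 + j)` with entire coefficients `c_j`.

Summing over `l` yields the functional equation

  `(1 - N b ^ (-s)) K(s) = B_1(s) + b ^ (-s) ∑_j c_j(s) K(s + 1 + j)`,

whose right-hand side involves only values of `K` further to the right, so that it continues `K`
strip by strip. At a zero `s` of `1 - N b ^ (-s)` the recursion telescopes, and `B_l(s)` tends to
the right-hand side; dividing by the derivative `log b` of `1 - N b ^ (-s)` gives the residue.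
-/

namespace RestrictedDirichlet

/-! ### Residues of quotients -/

theorem hasResidueAt_of_eventuallyEq_inv_mul {f g : ℂ → ℂ} {z : ℂ} (hg : AnalyticAt ℂ g z)
    (hf : f =ᶠ[𝓝[≠] z] fun w => (w - z)⁻¹ * g w) : HasResidueAt f z (g z) := by
  have hmer : MeromorphicAt (fun w => (w - z)⁻¹ * g w) z := by fun_prop
  refine ⟨hmer.congr hf.symm, ?_⟩
  obtain ⟨ρ, hρ, hball⟩ := Metric.eventually_nhds_iff_ball.1
    (hg.eventually_analyticAt.and (eventually_nhdsWithin_iff.1 hf))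
  filter_upwards [Ioo_mem_nhdsGT hρ] with r ⟨hr, hrρ⟩
  have hsub : Metric.closedBall z r ⊆ Metric.ball z ρ := Metric.closedBall_subset_ball hrρ
  have hg_ball : DifferentiableOn ℂ g (Metric.closedBall z r) := fun w hw =>
    (hball w (hsub hw)).1.differentiableAt.differentiableWithinAt
  calc ∮ w in C(z, r), f w = ∮ w in C(z, r), (w - z)⁻¹ • g w :=
        circleIntegral.integral_congr hr.le fun w hw =>
          (hball w (hsub (Metric.sphere_subset_closedBall hw))).2
            (Metric.ne_of_mem_sphere hw hr.ne')
    _ = 2 * Real.pi * Complex.I * g z :=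
        hg_ball.circleIntegral_sub_inv_smul (Metric.mem_ball_self hr)

theorem hasResidueAt_of_eventuallyEq_div {f g h : ℂ → ℂ} {z : ℂ} (hg : AnalyticAt ℂ g z)
    (hh : AnalyticAt ℂ h z) (hz : h z = 0) (hz' : deriv h z ≠ 0)
    (hf : f =ᶠ[𝓝[≠] z] fun w => g w / h w) : HasResidueAt f z ((deriv h z)⁻¹ * g z) := by
  have hslope : AnalyticAt ℂ (dslope h z) z := by
    have hnhds := hh.eventually_analyticAt
    exact ((Complex.differentiableOn_dslope hnhds).2 fun w hw =>
      AnalyticAt.differentiableWithinAt hw).analyticAt hnhds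
  have hquot : AnalyticAt ℂ (fun w => (dslope h z w)⁻¹ * g w) z :=
    (hslope.inv (by rwa [dslope_same])).mul hg
  rw [← dslope_same]
  refine hasResidueAt_of_eventuallyEq_inv_mul hquot (hf.trans (Eventually.of_forall fun w => ?_))
  have hfactor : (w - z) * dslope h z w = h w := by simpa [hz] using sub_smul_dslope h z w
  simp only [← hfactor, div_eq_inv_mul, mul_inv, mul_assoc]

/-! ### Continuation strip by strip -/

theorem frequently_re_gt (z : ℂ) : ∃ᶠ w in 𝓝[≠] z, z.re < w.re := by
  have hcont : ContinuousAt (fun t : ℝ => z + t) 0 := by fun_prop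
  have hright : Tendsto (fun t : ℝ => z + t) (𝓝[>] 0) (𝓝[≠] z) := by
    refine tendsto_nhdsWithin_iff.2 ⟨?_, ?_⟩
    · simpa using hcont.tendsto.mono_left nhdsWithin_le_nhds
    · filter_upwards [self_mem_nhdsWithin] with t ht
      simpa using ht.ne'
  refine hright.frequently (Eventually.frequently ?_)
  filter_upwards [self_mem_nhdsWithin] with t ht
  simpa using ht

theorem eventuallyEq_of_eqOn_re_gt {f g : ℂ → ℂ} {z : ℂ} (hf : MeromorphicAt f z)
    (hg : MeromorphicAt g z) (hfg : Set.EqOn f g {w | z.re < w.re}) : f =ᶠ[𝓝[≠] z] g :=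
  (hf.frequently_eq_iff_eventuallyEq hg).1 ((frequently_re_gt z).mono hfg)

theorem exists_meromorphic_forall_eqOn {σ : ℝ} {F : ℕ → ℂ → ℂ}
    (hmer : ∀ n : ℕ, MeromorphicOn (F n) {s | σ - n < s.re})
    (heq : ∀ n : ℕ, Set.EqOn (F (n + 1)) (F n) {s | σ - n < s.re}) :
    ∃ K, Meromorphic K ∧ ∀ n : ℕ, Set.EqOn K (F n) {s | σ - n < s.re} := by
  have heq_le {n m : ℕ} (hnm : n ≤ m) : Set.EqOn (F m) (F n) {s | σ - n < s.re} := by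
    induction m, hnm using Nat.le_induction with
    | base => exact fun _ _ => rfl
    | succ m hnm ih =>
      intro s hs
      have hnm' : (n : ℝ) ≤ m := by exact_mod_cast hnm
      exact (heq m ((sub_le_sub_left hnm' σ).trans_lt hs)).trans (ih hs)
  let index (s : ℂ) : ℕ := ⌊σ - s.re⌋₊ + 1
  have hindex (s : ℂ) : σ - index s < s.re := by
    have := Nat.lt_floor_add_one (σ - s.re)
    push_cast [index]
    linarith
  have hK (n : ℕ) : Set.EqOn (fun s => F (index s) s) (F n) {s | σ - n < s.re} := by
    intro s hs
    rcases le_total n (index s) with h | h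
    · exact heq_le h hs
    · exact (heq_le h (hindex s)).symm
  refine ⟨fun s => F (index s) s, fun s => (hmer _ s (hindex s)).congr ?_, hK⟩
  have hnhds : ∀ᶠ w in 𝓝 s, σ - index s < w.re := (Complex.isOpen_re_gt _).mem_nhds (hindex s)
  filter_upwards [hnhds.filter_mono nhdsWithin_le_nhds] with w hw
  exact (hK _ hw).symm

theorem exists_meromorphic_eqOn_of_fixedPoint {σ : ℝ} {L : ℂ → ℂ} {Φ : (ℂ → ℂ) → ℂ → ℂ}
    (hL : MeromorphicOn L {s | σ < s.re})
    (hfix : Set.EqOn (Φ L) L {s | σ < s.re})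
    (hlocal : ∀ {F G : ℂ → ℂ} {τ : ℝ}, Set.EqOn F G {s | τ < s.re} →
      Set.EqOn (Φ F) (Φ G) {s | τ - 1 < s.re})
    (hmer : ∀ {F : ℂ → ℂ} {τ : ℝ}, Set.EqOn F L {s | σ < s.re} →
      MeromorphicOn F {s | τ < s.re} → MeromorphicOn (Φ F) {s | τ - 1 < s.re}) :
    ∃ K, Meromorphic K ∧ Set.EqOn K L {s | σ < s.re} := by
  have hshift (n : ℕ) : σ - (n + 1 : ℕ) = σ - n - 1 := by push_cast; ring
  have heq (n : ℕ) : Set.EqOn (Φ^[n + 1] L) (Φ^[n] L) {s | σ - n < s.re} := by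
    induction n with
    | zero => simpa using hfix
    | succ n ih => simpa only [Function.iterate_succ_apply', hshift] using hlocal ih
  have heqL (n : ℕ) : Set.EqOn (Φ^[n] L) L {s | σ < s.re} := by
    induction n with
    | zero => exact fun _ _ => rfl
    | succ n ih =>
      intro s hs
      exact (heq n ((sub_le_self σ n.cast_nonneg).trans_lt hs)).trans (ih hs)
  have hmerIter (n : ℕ) : MeromorphicOn (Φ^[n] L) {s | σ - n < s.re} := by
    induction n with
    | zero => simpa using hL
    | succ n ih => simpa only [Function.iterate_succ_apply', hshift] using hmer (heqL n) ih
  obtain ⟨K, hK, hKeq⟩ := exists_meromorphic_forall_eqOn hmerIter heq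
  exact ⟨K, hK, by simpa using hKeq 0⟩

/-! ### Series of translates -/

/-- Coefficient sequences of entire functions whose series converges normally, that is, with a
summable bound on every disc around `0`. -/
structure NormallySummable (c : ℕ → ℂ → ℂ) : Prop where
  differentiable : ∀ j, Differentiable ℂ (c j)
  bound : ∀ R : ℝ, ∃ u : ℕ → ℝ, Summable u ∧ ∀ j s, ‖s‖ ≤ R → ‖c j s‖ ≤ u j

theorem NormallySummable.nat_add {c : ℕ → ℂ → ℂ} (hc : NormallySummable c) (n : ℕ) :
    NormallySummable fun j => c (j + n) where
  differentiable j := hc.differentiable (j + n)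
  bound R := by
    obtain ⟨u, hu, hcu⟩ := hc.bound R
    exact ⟨fun j => u (j + n), (summable_nat_add_iff n).2 hu, fun j => hcu (j + n)⟩

/-- `F` is holomorphic on the half-plane `Re s > σ` and bounded on every half-plane `Re s ≥ τ`
with `τ > σ`, as a Dirichlet series is to the right of its abscissa of absolute convergence. -/
structure HolomorphicBoundedRightOf (F : ℂ → ℂ) (σ : ℝ) : Prop where
  differentiableOn : DifferentiableOn ℂ F {s | σ < s.re}
  bound : ∀ τ > σ, ∃ M, ∀ s : ℂ, τ ≤ s.re → ‖F s‖ ≤ M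

theorem HolomorphicBoundedRightOf.congr {F G : ℂ → ℂ} {σ : ℝ} (hF : HolomorphicBoundedRightOf F σ)
    (hGF : Set.EqOn G F {s | σ < s.re}) : HolomorphicBoundedRightOf G σ where
  differentiableOn := hF.differentiableOn.congr hGF
  bound τ hτ := by
    obtain ⟨M, hM⟩ := hF.bound τ hτ
    exact ⟨M, fun s hs => (hGF (hτ.trans_le hs)).symm ▸ hM s hs⟩

theorem HolomorphicBoundedRightOf.comp_add_right {F : ℂ → ℂ} {σ : ℝ}
    (hF : HolomorphicBoundedRightOf F σ) (x : ℝ) :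
    HolomorphicBoundedRightOf (fun s => F (s + x)) (σ - x) where
  differentiableOn := hF.differentiableOn.comp (by fun_prop) fun s hs => by
    simpa [sub_lt_iff_lt_add] using hs
  bound τ hτ := by
    obtain ⟨M, hM⟩ := hF.bound (τ + x) (sub_lt_iff_lt_add.1 hτ)
    exact ⟨M, fun s hs => hM _ (by simpa using hs)⟩

/-- The series `∑ c_j(s) F(s + 1 + j)`. Expanding `φ(s, 1 / n)` in powers of `1 / n` turns a
Dirichlet series with terms `n ^ (-s - 1) φ(s, 1 / n)` into such a combination of translates of
the Dirichlet series `F` with terms `n ^ (-s)`. -/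
noncomputable def shiftSum (c : ℕ → ℂ → ℂ) (F : ℂ → ℂ) (s : ℂ) : ℂ :=
  ∑' j : ℕ, c j s * F (s + 1 + j)

theorem lt_re_add_one_add {τ : ℝ} {s : ℂ} (hs : τ - 1 < s.re) (j : ℕ) : τ < (s + 1 + j).re := by
  have : (0 : ℝ) ≤ j := j.cast_nonneg
  simp only [Complex.add_re, Complex.one_re, Complex.natCast_re]
  linarith

theorem eqOn_shiftSum {F G : ℂ → ℂ} {τ : ℝ} (c : ℕ → ℂ → ℂ) (hFG : Set.EqOn F G {s | τ < s.re}) :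
    Set.EqOn (shiftSum c F) (shiftSum c G) {s | τ - 1 < s.re} := fun s hs =>
  tsum_congr fun j => by rw [hFG (lt_re_add_one_add hs j)]

section ShiftSum

variable {c : ℕ → ℂ → ℂ} {F : ℂ → ℂ} {σ : ℝ}

theorem exists_summable_bound_shiftSum (hc : NormallySummable c)
    (hF : HolomorphicBoundedRightOf F σ) (R : ℝ) {τ : ℝ} (hτ : σ - 1 < τ) :
    ∃ u : ℕ → ℝ, Summable u ∧
      ∀ (j : ℕ) (s : ℂ), ‖s‖ ≤ R → τ ≤ s.re → ‖c j s * F (s + 1 + j)‖ ≤ u j := by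
  obtain ⟨u, hu, hcu⟩ := hc.bound R
  obtain ⟨M, hM⟩ := hF.bound (τ + 1) (by linarith)
  refine ⟨fun j => u j * M, hu.mul_right M, fun j s hsR hsτ => ?_⟩
  have hre : τ + 1 ≤ (s + 1 + j).re := by
    have : (0 : ℝ) ≤ j := j.cast_nonneg
    simp only [Complex.add_re, Complex.one_re, Complex.natCast_re]
    linarith
  rw [norm_mul]
  exact mul_le_mul (hcu j s hsR) (hM _ hre) (norm_nonneg _) ((norm_nonneg _).trans (hcu j s hsR))

theorem summable_shiftSum (hc : NormallySummable c) (hF : HolomorphicBoundedRightOf F σ) {s : ℂ}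
    (hs : σ - 1 < s.re) : Summable fun j : ℕ => c j s * F (s + 1 + j) := by
  obtain ⟨u, hu, hle⟩ := exists_summable_bound_shiftSum hc hF ‖s‖ hs
  exact .of_norm_bounded hu fun j => hle j s le_rfl le_rfl

theorem differentiableOn_shiftSum (hc : NormallySummable c) (hF : HolomorphicBoundedRightOf F σ) :
    DifferentiableOn ℂ (shiftSum c F) {s | σ - 1 < s.re} := by
  intro s hs
  obtain ⟨τ, hστ, hτs⟩ := exists_between (show σ - 1 < s.re from hs)
  obtain ⟨u, hu, hle⟩ := exists_summable_bound_shiftSum hc hF (‖s‖ + 1) hστ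
  let U : Set ℂ := Metric.ball 0 (‖s‖ + 1) ∩ {w | τ < w.re}
  have hU : IsOpen U := Metric.isOpen_ball.inter (Complex.isOpen_re_gt τ)
  have hsU : s ∈ U := ⟨by simp, hτs⟩
  have hterm (j : ℕ) : DifferentiableOn ℂ (fun w => c j w * F (w + 1 + j)) U :=
    (hc.differentiable j).differentiableOn.mul <|
      hF.differentiableOn.comp (by fun_prop) fun w hw => lt_re_add_one_add (hστ.trans hw.2) j
  have hdiff : DifferentiableOn ℂ (shiftSum c F) U :=
    Complex.differentiableOn_tsum_of_summable_norm hu hterm hU fun j w hw =>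
      hle j w (mem_ball_zero_iff.1 hw.1).le hw.2.le
  exact (hdiff.differentiableAt (hU.mem_nhds hsU)).differentiableWithinAt

theorem shiftSum_eq_sum_add_shiftSum (hc : NormallySummable c)
    (hF : HolomorphicBoundedRightOf F σ) (n : ℕ) {s : ℂ} (hs : σ - n - 1 < s.re) :
    shiftSum c F s = ∑ j ∈ Finset.range n, c j s * F (s + 1 + j) +
      shiftSum (fun j => c (j + n)) (fun w => F (w + (n : ℝ))) s := by
  have htail (j : ℕ) : c (j + n) s * F (s + 1 + (j + n : ℕ)) =
      c (j + n) s * F (s + 1 + j + (n : ℝ)) := by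
    push_cast
    ring_nf
  have hsum : Summable fun j => c (j + n) s * F (s + 1 + (j + n : ℕ)) :=
    (summable_shiftSum (hc.nat_add n) (hF.comp_add_right n) hs).congr fun j => (htail j).symm
  have hsum' := (summable_nat_add_iff (f := fun j => c j s * F (s + 1 + j)) n).1 hsum
  exact (hsum'.sum_add_tsum_nat_add n).symm.trans (congrArg _ (tsum_congr htail))

theorem meromorphicOn_shiftSum (hc : NormallySummable c) (hF : HolomorphicBoundedRightOf F σ)
    {τ : ℝ} (hmer : MeromorphicOn F {s | τ < s.re}) :
    MeromorphicOn (shiftSum c F) {s | τ - 1 < s.re} := by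
  intro s hs
  -- Near `s`, all but finitely many of the points `s + 1 + j` lie where `F` is holomorphic.
  obtain ⟨n, hn⟩ := exists_nat_gt (σ - 1 - s.re)
  have hsn : s ∈ {w : ℂ | σ - n - 1 < w.re} := by
    rw [Set.mem_ofPred_eq]
    linarith
  have hnhds := (Complex.isOpen_re_gt (σ - n - 1)).mem_nhds hsn
  have htail := ((differentiableOn_shiftSum (hc.nat_add n) (hF.comp_add_right n)).analyticAt
    hnhds).meromorphicAt
  have hhead : MeromorphicAt (fun w => ∑ j ∈ Finset.range n, c j w * F (w + 1 + j)) s :=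
    .fun_sum fun j _ => ((hc.differentiable j).analyticAt s).meromorphicAt.mul <|
      (hmer _ (lt_re_add_one_add hs j)).comp_analyticAt (g := fun w : ℂ => w + 1 + j) (by fun_prop)
  refine (hhead.add htail).congr ?_
  filter_upwards [nhdsWithin_le_nhds hnhds] with w hw
  exact (shiftSum_eq_sum_add_shiftSum hc hF n hw).symm

end ShiftSum

/-! ### Dirichlet series -/

theorem holomorphicBoundedRightOf_LSeries {f : ℕ → ℂ} {σ : ℝ}
    (h : LSeries.abscissaOfAbsConv f ≤ σ) : HolomorphicBoundedRightOf (LSeries f) σ where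
  differentiableOn := (LSeries_differentiableOn f).mono fun s hs =>
    h.trans_lt (EReal.coe_lt_coe_iff.2 hs)
  bound τ hτ := by
    have hsum : LSeriesSummable f τ := LSeriesSummable_of_abscissaOfAbsConv_lt_re <|
      h.trans_lt (EReal.coe_lt_coe_iff.2 hτ)
    exact ⟨∑' n, ‖LSeries.term f τ n‖, fun s hs => tsum_of_norm_bounded hsum.norm.hasSum fun n =>
      LSeries.norm_term_le_of_re_le_re f hs n⟩

theorem term_mul_inv_pow (f : ℕ → ℂ) (s : ℂ) (n j : ℕ) :
    LSeries.term f s n * ((n : ℂ)⁻¹) ^ j = LSeries.term f (s + j) n := by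
  rcases eq_or_ne n 0 with rfl | hn
  · simp
  · rw [LSeries.term_of_ne_zero hn, LSeries.term_of_ne_zero hn,
      Complex.cpow_add _ _ (Nat.cast_ne_zero.2 hn), Complex.cpow_natCast, inv_pow,
      ← div_eq_mul_inv, div_div]

theorem hasSum_term_mul_tsum {f c : ℕ → ℂ} {s : ℂ} (hf : LSeriesSummable f s)
    (hc : Summable fun j => ‖c j‖) :
    HasSum (fun n : ℕ => LSeries.term f s n * ∑' j, c j * ((n : ℂ)⁻¹) ^ j)
      (∑' j : ℕ, c j * LSeries f (s + j)) := by
  let T (p : ℕ × ℕ) : ℂ := c p.2 * LSeries.term f (s + p.2) p.1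
  have hbound (p : ℕ × ℕ) : ‖T p‖ ≤ ‖LSeries.term f s p.1‖ * ‖c p.2‖ := by
    rw [norm_mul, mul_comm]
    gcongr
    exact LSeries.norm_term_le_of_re_le_re f (by simp) p.1
  have hT : Summable T := .of_norm_bounded
    (hf.norm.mul_of_nonneg hc (fun _ => norm_nonneg _) fun _ => norm_nonneg _) hbound
  have hrow (n : ℕ) : HasSum (fun j => T (n, j))
      (LSeries.term f s n * ∑' j, c j * ((n : ℂ)⁻¹) ^ j) := by
    have hTn (j : ℕ) : T (n, j) = LSeries.term f s n * (c j * ((n : ℂ)⁻¹) ^ j) := by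
      rw [mul_left_comm, term_mul_inv_pow]
    simpa only [hTn, tsum_mul_left] using (hT.prod_factor n).hasSum
  convert hT.hasSum.prod_fiberwise hrow using 1
  calc ∑' j : ℕ, c j * LSeries f (s + j) = ∑' (j : ℕ) (n : ℕ), T (n, j) :=
        tsum_congr fun j => tsum_mul_left.symm
    _ = ∑' p, T p := (Summable.tsum_comm (f := fun n j => T (n, j)) hT).trans hT.tsum_prod.symm

theorem term_indicator_one {S : Set ℕ} (hS : 0 ∉ S) (s : ℂ) :
    LSeries.term (S.indicator 1) s = S.indicator fun n => (n : ℂ) ^ (-s) := by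
  ext n
  by_cases hn : n ∈ S
  · rw [LSeries.term_of_ne_zero (ne_of_mem_of_not_mem hn hS), Set.indicator_of_mem hn,
      Set.indicator_of_mem hn, Pi.one_apply, one_div, Complex.cpow_neg]
  · simp [LSeries.term, hn]

theorem hasSum_term_indicator_one_mul {S : Set ℕ} (hS : 0 ∉ S) {s : ℂ} {G : ℕ → ℂ} {x : ℂ} :
    HasSum (fun n => LSeries.term (S.indicator 1) s n * G n) x ↔
      HasSum (fun n : S => ((n : ℕ) : ℂ) ^ (-s) * G n) x := by
  have hmul (n : ℕ) : LSeries.term (S.indicator 1) s n * G n =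
      S.indicator (fun n => (n : ℂ) ^ (-s) * G n) n := by
    rw [term_indicator_one hS, ← Set.indicator_mul_left]
  simp only [hmul]
  exact hasSum_subtype_iff_indicator.symm

/-! ### Blocks of admissible integers -/

section Blocks

variable {b : ℕ} {A : Finset ℕ}

theorem add_mul_mem_block_succ (hb : 1 < b) {a m : ℕ} (ha : a < b) (h : a ≠ 0 ∨ m ≠ 0) (l : ℕ) :
    a + b * m ∈ block b A (l + 1) ↔ a ∈ A ∧ m ∈ block b A l := by
  simp only [mem_block hb, len, Admissible, Nat.digits_add b hb a m ha h, List.length_cons,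
    List.forall_mem_cons, Nat.add_right_cancel_iff]
  tauto

theorem pos_of_mem_block_succ (hb : 1 < b) {l n : ℕ} (hn : n ∈ block b A (l + 1)) : 0 < n := by
  rcases Nat.eq_zero_or_pos n with rfl | h
  · simp [mem_block hb, len] at hn
  · exact h

theorem sum_block_add_two {E : Type*} [AddCommMonoid E] (hb : 1 < b) (hAb : ∀ a ∈ A, a < b)
    (F : ℕ → E) (l : ℕ) :
    ∑ n ∈ block b A (l + 2), F n = ∑ m ∈ block b A (l + 1), ∑ a ∈ A, F (a + b * m) := by
  have hb0 : 0 < b := by positivity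
  have hdiv {n : ℕ} (hn : n ∈ block b A (l + 2)) : n % b ∈ A ∧ n / b ∈ block b A (l + 1) := by
    refine (add_mul_mem_block_succ hb (n.mod_lt hb0) ?_ (l + 1)).1 (by rwa [Nat.mod_add_div])
    by_contra! h
    refine (pos_of_mem_block_succ hb hn).ne' ?_
    rw [← Nat.mod_add_div n b, h.1, h.2, mul_zero, add_zero]
  rw [← Finset.sum_product']
  refine Finset.sum_nbij' (fun n => (n / b, n % b)) (fun p => p.2 + b * p.1) ?_ ?_ ?_ ?_ ?_
  · exact fun n hn => Finset.mem_product.2 (hdiv hn).symm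
  · intro p hp
    obtain ⟨hm, ha⟩ := Finset.mem_product.1 hp
    exact (add_mul_mem_block_succ hb (hAb _ ha) (.inr (pos_of_mem_block_succ hb hm).ne') _).2
      ⟨ha, hm⟩
  · exact fun n _ => Nat.mod_add_div n b
  · intro p hp
    have ha := hAb _ (Finset.mem_product.1 hp).2
    ext
    · simp [Nat.add_mul_div_left _ _ hb0, Nat.div_eq_of_lt ha]
    · simp [Nat.mod_eq_of_lt ha]
  · exact fun n _ => by rw [Nat.mod_add_div]

/-- The positive admissible integers, as the index type of the Dirichlet series. -/
abbrev positiveAdmissible (b : ℕ) (A : Finset ℕ) : Set ℕ := {n | 0 < n ∧ Admissible b A n}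

/-- Positive admissible integers sorted by their length, which runs over `l + 1` for `l : ℕ`. -/
noncomputable def sigmaBlockEquiv (hb : 1 < b) :
    (Σ l, block b A (l + 1)) ≃ positiveAdmissible b A :=
  Equiv.ofBijective
    (fun x => ⟨x.2, pos_of_mem_block_succ hb x.2.2, ((mem_block hb _ _ _).1 x.2.2).2⟩) <| by
    constructor
    · rintro ⟨l, n, hn⟩ ⟨l', n', hn'⟩ h
      obtain rfl : n = n' := congrArg Subtype.val h
      obtain rfl : l = l' := Nat.succ_injective <|
        ((mem_block hb _ _ _).1 hn).1.symm.trans ((mem_block hb _ _ _).1 hn').1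
      rfl
    · rintro ⟨n, hpos, hn⟩
      have hlen : len b n = len b n - 1 + 1 := by
        have : Nat.digits b n ≠ [] := Nat.digits_ne_nil_iff_ne_zero.2 hpos.ne'
        have := List.length_pos_iff.2 this
        rw [len]
        omega
      exact ⟨⟨len b n - 1, n, (mem_block hb _ _ _).2 ⟨hlen, hn⟩⟩, rfl⟩

theorem hasSum_sum_block {E : Type*} [AddCommMonoid E] [TopologicalSpace E] [ContinuousAdd E]
    [RegularSpace E] (hb : 1 < b) {F : ℕ → E} {x : E}
    (hF : HasSum (fun n : positiveAdmissible b A => F n) x) :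
    HasSum (fun l => ∑ n ∈ block b A (l + 1), F n) x :=
  ((sigmaBlockEquiv hb).hasSum_iff.2 hF).sigma fun l => (block b A (l + 1)).hasSum F

theorem summable_of_summable_sum_block (hb : 1 < b) {F : ℕ → ℝ} (hF : ∀ n, 0 ≤ F n)
    (hsum : Summable fun l => ∑ n ∈ block b A (l + 1), F n) :
    Summable fun n : positiveAdmissible b A => F n := by
  refine (sigmaBlockEquiv hb).summable_iff.1 <|
    (summable_sigma_of_nonneg fun _ => hF _).2 ⟨fun _ => .of_finite, ?_⟩
  exact hsum.congr fun l => (Finset.tsum_subtype (block b A (l + 1)) F).symm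

theorem card_mul_rpow_lt_one (hb : 1 < b) (hA : A.Nonempty) {σ : ℝ}
    (hσ : Real.logb b A.card < σ) : A.card * (b : ℝ) ^ (-σ) < 1 := by
  have hb1 : (1 : ℝ) < b := by exact_mod_cast hb
  have hlt := (Real.logb_lt_iff_lt_rpow hb1 (by exact_mod_cast hA.card_pos)).1 hσ
  rwa [Real.rpow_neg (by positivity), ← div_eq_mul_inv, div_lt_one (by positivity)]

theorem sum_block_rpow_add_two_le (hb : 1 < b) (hAb : ∀ a ∈ A, a < b) {σ : ℝ} (hσ : 0 ≤ σ)
    (l : ℕ) : ∑ n ∈ block b A (l + 2), (n : ℝ) ^ (-σ) ≤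
      A.card * (b : ℝ) ^ (-σ) * ∑ m ∈ block b A (l + 1), (m : ℝ) ^ (-σ) := by
  rw [sum_block_add_two hb hAb, Finset.mul_sum]
  refine Finset.sum_le_sum fun m hm => ?_
  have hm0 : (0 : ℝ) < m := by exact_mod_cast pos_of_mem_block_succ hb hm
  have hb0 : (0 : ℝ) < b := by positivity
  calc ∑ a ∈ A, ((a + b * m : ℕ) : ℝ) ^ (-σ)
      ≤ ∑ _a ∈ A, ((b : ℝ) * m) ^ (-σ) := by
        refine Finset.sum_le_sum fun a _ =>
          Real.rpow_le_rpow_of_nonpos (by positivity) ?_ (by linarith)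
        push_cast
        exact le_add_of_nonneg_left a.cast_nonneg
    _ = A.card * (b : ℝ) ^ (-σ) * (m : ℝ) ^ (-σ) := by
        rw [Finset.sum_const, nsmul_eq_mul, Real.mul_rpow hb0.le hm0.le, mul_assoc]

theorem summable_positiveAdmissible_rpow (hb : 1 < b) (hAb : ∀ a ∈ A, a < b) (hA : A.Nonempty)
    {σ : ℝ} (hσ : Real.logb b A.card < σ) :
    Summable fun n : positiveAdmissible b A => ((n : ℕ) : ℝ) ^ (-σ) := by
  have hσ0 : 0 ≤ σ := (Real.logb_nonneg (by exact_mod_cast hb)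
    (by exact_mod_cast hA.card_pos)).trans hσ.le
  have hnonneg (l : ℕ) : 0 ≤ ∑ n ∈ block b A (l + 1), (n : ℝ) ^ (-σ) :=
    Finset.sum_nonneg fun n _ => by positivity
  refine summable_of_summable_sum_block hb (F := fun n => (n : ℝ) ^ (-σ)) (by intro; positivity) <|
    summable_of_ratio_norm_eventually_le (card_mul_rpow_lt_one hb hA hσ) <|
      .of_forall fun l => ?_
  rw [Real.norm_of_nonneg (hnonneg _), Real.norm_of_nonneg (hnonneg l)]
  exact sum_block_rpow_add_two_le hb hAb hσ0 l

/-- The Dirichlet series `∑ n ^ (-s)` over the positive admissible integers `n`; as any `LSeries`,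
it is `0` where it does not converge. -/
noncomputable def dirichletSeries (b : ℕ) (A : Finset ℕ) : ℂ → ℂ :=
  LSeries ((positiveAdmissible b A).indicator 1)

theorem abscissaOfAbsConv_indicator_positiveAdmissible_le (hb : 1 < b) (hAb : ∀ a ∈ A, a < b)
    (hA : A.Nonempty) :
    LSeries.abscissaOfAbsConv ((positiveAdmissible b A).indicator 1) ≤ Real.logb b A.card := by
  refine LSeries.abscissaOfAbsConv_le_of_forall_lt_LSeriesSummable fun σ hσ => ?_
  have hterm : Summable fun n : positiveAdmissible b A => ((n : ℕ) : ℂ) ^ (-σ : ℂ) := by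
    refine .of_norm ((summable_positiveAdmissible_rpow hb hAb hA hσ).congr fun n => ?_)
    rw [Complex.norm_natCast_cpow_of_pos n.2.1, Complex.neg_re, Complex.ofReal_re]
  rw [LSeriesSummable, term_indicator_one (by simp)]
  exact summable_subtype_iff_indicator.1 hterm

theorem holomorphicBoundedRightOf_dirichletSeries (hb : 1 < b) (hAb : ∀ a ∈ A, a < b)
    (hA : A.Nonempty) : HolomorphicBoundedRightOf (dirichletSeries b A) (Real.logb b A.card) :=
  holomorphicBoundedRightOf_LSeries
    (abscissaOfAbsConv_indicator_positiveAdmissible_le hb hAb hA)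

theorem lSeriesSummable_indicator_positiveAdmissible (hb : 1 < b) (hAb : ∀ a ∈ A, a < b)
    (hA : A.Nonempty) {s : ℂ} (hs : Real.logb b A.card < s.re) :
    LSeriesSummable ((positiveAdmissible b A).indicator 1) s :=
  LSeriesSummable_of_abscissaOfAbsConv_lt_re <|
    (abscissaOfAbsConv_indicator_positiveAdmissible_le hb hAb hA).trans_lt
      (EReal.coe_lt_coe_iff.2 hs)

theorem hasSum_dirichletSeries (hb : 1 < b) (hAb : ∀ a ∈ A, a < b) (hA : A.Nonempty) {s : ℂ}
    (hs : Real.logb b A.card < s.re) :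
    HasSum (fun n : positiveAdmissible b A => ((n : ℕ) : ℂ) ^ (-s)) (dirichletSeries b A s) := by
  have h := (lSeriesSummable_indicator_positiveAdmissible hb hAb hA hs).LSeriesHasSum
  rw [LSeriesHasSum, term_indicator_one (by simp)] at h
  exact hasSum_subtype_iff_indicator.2 h

end Blocks

/-! ### Binomial expansion of the digit sums -/

theorem choose_succ_eq_mul_div (x : ℂ) (j : ℕ) :
    Ring.choose x (j + 1) = Ring.choose x j * ((x - j) / (j + 1)) := by
  have h := Ring.choose_smul_choose x (j.le_add_right 1)
  rw [Nat.choose_succ_self_right, Nat.add_sub_cancel_left, Ring.choose_one_right, nsmul_eq_mul,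
    Nat.cast_add_one] at h
  rw [← mul_div_assoc, eq_div_iff (Nat.cast_add_one_ne_zero j), mul_comm, h]

theorem differentiable_choose (j : ℕ) : Differentiable ℂ fun x : ℂ => Ring.choose x j := by
  induction j with
  | zero => simp
  | succ j ih =>
    simp only [choose_succ_eq_mul_div]
    fun_prop

theorem norm_choose_le {R : ℕ} {x : ℂ} (hx : ‖x‖ ≤ R) (j : ℕ) :
    ‖Ring.choose x j‖ ≤ (j + R).choose j := by
  induction j with
  | zero => simp
  | succ j ih =>
    have hrec : (((j + 1 + R).choose (j + 1) : ℕ) : ℝ) =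
        (j + R).choose j * ((j + R + 1) / (j + 1)) := by
      rw [← mul_div_assoc, eq_div_iff (Nat.cast_add_one_ne_zero j), mul_comm ((j + R).choose j : ℝ),
        add_right_comm j 1 R]
      exact_mod_cast (Nat.add_one_mul_choose_eq (j + R) j).symm
    have hnum : ‖x - j‖ ≤ j + R + 1 := by
      have := norm_sub_le x j
      rw [Complex.norm_natCast] at this
      linarith
    have hden : ‖(j : ℂ) + 1‖ = j + 1 := by exact_mod_cast Complex.norm_natCast (j + 1)
    rw [choose_succ_eq_mul_div, norm_mul, norm_div, hden, hrec]
    gcongr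

theorem hasSum_choose_mul_pow {x : ℂ} (hx : ‖x‖ < 1) (z : ℂ) :
    HasSum (fun j => Ring.choose z j * x ^ j) ((1 + x) ^ z) := by
  have h := (Complex.one_add_cpow_hasFPowerSeriesOnBall_zero (a := z)).hasSum (y := x)
    (by simpa [Metric.mem_eball, edist_zero_right, enorm_eq_nnnorm, ← NNReal.coe_lt_coe] using hx)
  simpa [List.prod_ofFn, -FormalMultilinearSeries.apply_eq_prod_smul_coeff, mul_comm] using h

theorem natCast_add_mul_cpow {b m : ℕ} (hb : b ≠ 0) (hm : m ≠ 0) (a : ℕ) (z : ℂ) :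
    ((a + b * m : ℕ) : ℂ) ^ z =
      (b : ℂ) ^ z * (m : ℂ) ^ z * (1 + (a : ℂ) / b * (m : ℂ)⁻¹) ^ z := by
  have hfactor : (a + b * m : ℂ) = b * m * (1 + a / b * (m : ℂ)⁻¹) := by
    field_simp
    ring
  have h := Complex.mul_cpow_ofReal_nonneg (a := b * m) (b := 1 + a / b * (m : ℝ)⁻¹)
    (by positivity) (by positivity) z
  push_cast at h ⊢
  rw [hfactor, h, ← Complex.natCast_mul_natCast_cpow]

section Digits

variable {b : ℕ} {A : Finset ℕ}

/-- The coefficient of `x ^ (j + 1)` in the expansion of `∑ a ∈ A, (1 + (a / b) x) ^ (-s)`; the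
constant coefficient `#A` is left out. -/
noncomputable def digitCoeff (b : ℕ) (A : Finset ℕ) (j : ℕ) (s : ℂ) : ℂ :=
  Ring.choose (-s) (j + 1) * ∑ a ∈ A, ((a : ℂ) / b) ^ (j + 1)

theorem norm_digit_div_lt_one (hAb : ∀ a ∈ A, a < b) {a : ℕ} (ha : a ∈ A) :
    ‖(a : ℂ) / b‖ < 1 := by
  have hab : (a : ℝ) < b := by exact_mod_cast hAb a ha
  rw [norm_div, Complex.norm_natCast, Complex.norm_natCast]
  exact (div_lt_one (a.cast_nonneg.trans_lt hab)).2 hab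

theorem normallySummable_digitCoeff (hAb : ∀ a ∈ A, a < b) :
    NormallySummable (digitCoeff b A) where
  differentiable j := ((differentiable_choose (j + 1)).comp differentiable_neg).mul_const _
  bound R := by
    let u (j : ℕ) : ℝ := ∑ a ∈ A, (j + ⌈R⌉₊).choose ⌈R⌉₊ * ‖(a : ℂ) / b‖ ^ j
    have hu : Summable u := summable_sum fun a ha =>
      summable_choose_mul_geometric_of_norm_lt_one _ (by simpa using norm_digit_div_lt_one hAb ha)
    refine ⟨fun j => u (j + 1), (summable_nat_add_iff 1).2 hu, fun j s hs => ?_⟩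
    have hchoose := norm_choose_le ((norm_neg s).trans_le (hs.trans (Nat.le_ceil R))) (j + 1)
    rw [Nat.choose_symm_add] at hchoose
    simp only [u, ← Finset.mul_sum]
    rw [digitCoeff, norm_mul]
    gcongr
    exact (norm_sum_le _ _).trans_eq (by simp only [norm_pow])

theorem hasSum_digitCoeff_mul_pow (hAb : ∀ a ∈ A, a < b) (s : ℂ) {x : ℂ} (hx : ‖x‖ ≤ 1) :
    HasSum (fun j => digitCoeff b A j s * x ^ (j + 1))
      (∑ a ∈ A, (1 + (a : ℂ) / b * x) ^ (-s) - A.card) := by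
  have hdigit {a : ℕ} (ha : a ∈ A) :
      HasSum (fun j => Ring.choose (-s) (j + 1) * ((a : ℂ) / b * x) ^ (j + 1))
        ((1 + (a : ℂ) / b * x) ^ (-s) - 1) := by
    have hax : ‖(a : ℂ) / b * x‖ < 1 := by
      rw [norm_mul]
      exact (mul_le_of_le_one_right (norm_nonneg _) hx).trans_lt (norm_digit_div_lt_one hAb ha)
    simpa using (hasSum_nat_add_iff' 1).2 (hasSum_choose_mul_pow hax (-s))
  have h := hasSum_sum fun a ha => hdigit ha
  rw [Finset.sum_sub_distrib, Finset.sum_const, nsmul_one] at h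
  refine h.congr_fun fun j => ?_
  simp only [digitCoeff, mul_pow, Finset.mul_sum, Finset.sum_mul, mul_assoc]

/-- The error made in replacing each of the terms `(a + b m) ^ (-s)`, `a ∈ A`, by
`(b m) ^ (-s)`. -/
noncomputable def digitError (b : ℕ) (A : Finset ℕ) (s : ℂ) (m : ℕ) : ℂ :=
  ∑ a ∈ A, ((a + b * m : ℕ) : ℂ) ^ (-s) - A.card * (b : ℂ) ^ (-s) * (m : ℂ) ^ (-s)

theorem digitError_eq (hb : b ≠ 0) (hAb : ∀ a ∈ A, a < b) (s : ℂ) {m : ℕ} (hm : 0 < m) :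
    digitError b A s m =
      (b : ℂ) ^ (-s) * ((m : ℂ) ^ (-(s + 1)) * ∑' j, digitCoeff b A j s * ((m : ℂ)⁻¹) ^ j) := by
  have hinv : ‖(m : ℂ)⁻¹‖ ≤ 1 := by
    rw [norm_inv, Complex.norm_natCast]
    exact inv_le_one_of_one_le₀ (by exact_mod_cast hm)
  have hexpand := (hasSum_digitCoeff_mul_pow hAb s hinv).tsum_eq
  simp only [pow_succ, ← mul_assoc, tsum_mul_right] at hexpand
  have hsum : ∑ a ∈ A, ((a + b * m : ℕ) : ℂ) ^ (-s) =
      (b : ℂ) ^ (-s) * (m : ℂ) ^ (-s) * ∑ a ∈ A, (1 + (a : ℂ) / b * (m : ℂ)⁻¹) ^ (-s) := by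
    rw [Finset.mul_sum]
    exact Finset.sum_congr rfl fun a _ => natCast_add_mul_cpow hb hm.ne' a (-s)
  have hm0 : (m : ℂ) ≠ 0 := Nat.cast_ne_zero.2 hm.ne'
  rw [digitError, hsum, neg_add, Complex.cpow_add _ _ hm0, Complex.cpow_neg_one]
  linear_combination -(b : ℂ) ^ (-s) * (m : ℂ) ^ (-s) * hexpand

theorem hasSum_digitError (hb : 1 < b) (hAb : ∀ a ∈ A, a < b) (hA : A.Nonempty) {s : ℂ}
    (hs : Real.logb b A.card - 1 < s.re) :
    HasSum (fun m : positiveAdmissible b A => digitError b A s m)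
      ((b : ℂ) ^ (-s) * shiftSum (digitCoeff b A) (dirichletSeries b A) s) := by
  have hcoeff : Summable fun j => ‖digitCoeff b A j s‖ := by
    obtain ⟨u, hu, hle⟩ := (normallySummable_digitCoeff hAb).bound ‖s‖
    exact .of_nonneg_of_le (fun _ => norm_nonneg _) (fun j => hle j s le_rfl) hu
  have hL : LSeriesSummable ((positiveAdmissible b A).indicator 1) (s + 1) :=
    lSeriesSummable_indicator_positiveAdmissible hb hAb hA (sub_lt_iff_lt_add.1 hs)
  have h := (hasSum_term_indicator_one_mul (by simp)).1 (hasSum_term_mul_tsum hL hcoeff)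
  refine (h.mul_left ((b : ℂ) ^ (-s))).congr_fun fun m => ?_
  exact digitError_eq (by positivity) hAb s m.2.1

end Digits

/-! ### The functional equation and the residues -/

section Continuation

variable {b : ℕ} {A : Finset ℕ}

/-- The sum of `n ^ (-s)` over the admissible integers of length `l`. -/
noncomputable def blockSum (b : ℕ) (A : Finset ℕ) (l : ℕ) (s : ℂ) : ℂ :=
  ∑ n ∈ block b A l, (n : ℂ) ^ (-s)

theorem blockSum_add_two (hb : 1 < b) (hAb : ∀ a ∈ A, a < b) (l : ℕ) (s : ℂ) :
    blockSum b A (l + 2) s = A.card * (b : ℂ) ^ (-s) * blockSum b A (l + 1) s +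
      ∑ m ∈ block b A (l + 1), digitError b A s m := by
  simp only [blockSum, digitError, sum_block_add_two hb hAb, Finset.sum_sub_distrib,
    ← Finset.mul_sum, add_sub_cancel]

theorem differentiable_natCast_cpow_neg {n : ℕ} (hn : n ≠ 0) :
    Differentiable ℂ fun s : ℂ => (n : ℂ) ^ (-s) := fun _ =>
  differentiableAt_id.neg.const_cpow (.inl (Nat.cast_ne_zero.2 hn))

theorem differentiable_blockSum_succ (hb : 1 < b) (l : ℕ) :
    Differentiable ℂ (blockSum b A (l + 1)) :=
  .fun_sum fun _ hn => differentiable_natCast_cpow_neg (pos_of_mem_block_succ hb hn).ne'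

/-- The factor by which the Dirichlet series has to be multiplied to remove its poles on the line
`Re s = log_b #A`. -/
noncomputable def poleFactor (b : ℕ) (A : Finset ℕ) (s : ℂ) : ℂ := 1 - A.card * (b : ℂ) ^ (-s)

/-- The right-hand side `R` of the functional equation `poleFactor b A s * F s = R F s` satisfied
by the Dirichlet series `F`. It depends only on the values of `F` at the points `s + 1 + j`. -/
noncomputable def shiftedSide (b : ℕ) (A : Finset ℕ) (F : ℂ → ℂ) (s : ℂ) : ℂ :=
  blockSum b A 1 s + (b : ℂ) ^ (-s) * shiftSum (digitCoeff b A) F s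

theorem differentiable_poleFactor (hb : b ≠ 0) : Differentiable ℂ (poleFactor b A) :=
  ((differentiable_natCast_cpow_neg hb).const_mul _).const_sub _

theorem poleFactor_ne_zero (hb : 1 < b) (hA : A.Nonempty) {s : ℂ}
    (hs : Real.logb b A.card < s.re) : poleFactor b A s ≠ 0 := by
  refine sub_ne_zero.2 fun h => (card_mul_rpow_lt_one hb hA hs).ne' ?_
  simpa [Complex.norm_natCast_cpow_of_pos (zero_lt_one.trans hb)] using congrArg norm h

theorem poleFactor_mul_dirichletSeries (hb : 1 < b) (hAb : ∀ a ∈ A, a < b) (hA : A.Nonempty)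
    {s : ℂ} (hs : Real.logb b A.card < s.re) :
    poleFactor b A s * dirichletSeries b A s = shiftedSide b A (dirichletSeries b A) s := by
  have hblocks : HasSum (fun l => blockSum b A (l + 1) s) (dirichletSeries b A s) :=
    hasSum_sum_block hb (F := fun n => (n : ℂ) ^ (-s)) (hasSum_dirichletSeries hb hAb hA hs)
  have herror := hasSum_sum_block hb
    (hasSum_digitError hb hAb hA ((sub_le_self _ zero_le_one).trans_lt hs))
  have hrec := (hblocks.mul_left (A.card * (b : ℂ) ^ (-s))).add herror
  simp only [← blockSum_add_two hb hAb] at hrec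
  have htail := (hasSum_nat_add_iff' 1).2 hblocks
  rw [Finset.sum_range_one] at htail
  rw [poleFactor, shiftedSide]
  linear_combination htail.unique hrec

theorem eqOn_dirichletSeries_div (hb : 1 < b) (hAb : ∀ a ∈ A, a < b) (hA : A.Nonempty) :
    Set.EqOn (dirichletSeries b A)
      (fun s => shiftedSide b A (dirichletSeries b A) s / poleFactor b A s)
      {s | Real.logb b A.card < s.re} := fun _ hs =>
  eq_div_of_mul_eq (poleFactor_ne_zero hb hA hs) <|
    (mul_comm _ _).trans (poleFactor_mul_dirichletSeries hb hAb hA hs)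

theorem eqOn_shiftedSide {F G : ℂ → ℂ} {τ : ℝ} (hFG : Set.EqOn F G {s | τ < s.re}) :
    Set.EqOn (shiftedSide b A F) (shiftedSide b A G) {s | τ - 1 < s.re} := fun s hs => by
  rw [shiftedSide, shiftedSide, eqOn_shiftSum (digitCoeff b A) hFG hs]

theorem meromorphicOn_shiftedSide (hb : 1 < b) (hAb : ∀ a ∈ A, a < b) {F : ℂ → ℂ} {σ τ : ℝ}
    (hF : HolomorphicBoundedRightOf F σ) (hmer : MeromorphicOn F {s | τ < s.re}) :
    MeromorphicOn (shiftedSide b A F) {s | τ - 1 < s.re} := fun s hs =>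
  ((differentiable_blockSum_succ hb 0).analyticAt s).meromorphicAt.add <|
    ((differentiable_natCast_cpow_neg (by positivity)).analyticAt s).meromorphicAt.mul <|
      meromorphicOn_shiftSum (normallySummable_digitCoeff hAb) hF hmer s hs

theorem analyticAt_shiftedSide (hb : 1 < b) (hAb : ∀ a ∈ A, a < b) {F : ℂ → ℂ} {σ : ℝ}
    (hF : HolomorphicBoundedRightOf F σ) {s : ℂ} (hs : σ - 1 < s.re) :
    AnalyticAt ℂ (shiftedSide b A F) s :=
  ((differentiable_blockSum_succ hb 0).analyticAt s).add <|
    ((differentiable_natCast_cpow_neg (by positivity)).analyticAt s).mul <|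
      (differentiableOn_shiftSum (normallySummable_digitCoeff hAb) hF).analyticAt <|
        (Complex.isOpen_re_gt _).mem_nhds hs

theorem exists_isMeromorphicContinuation (hb : 1 < b) (hAb : ∀ a ∈ A, a < b) (hA : A.Nonempty) :
    ∃ K, IsMeromorphicContinuation b A K := by
  have hL := holomorphicBoundedRightOf_dirichletSeries hb hAb hA
  have hfactor (s : ℂ) : MeromorphicAt (poleFactor b A) s :=
    ((differentiable_poleFactor (by positivity)).analyticAt s).meromorphicAt
  obtain ⟨K, hK, hKL⟩ := exists_meromorphic_eqOn_of_fixedPoint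
    (Φ := fun F s => shiftedSide b A F s / poleFactor b A s)
    (hL.differentiableOn.analyticOnNhd (Complex.isOpen_re_gt _)).meromorphicOn
    (eqOn_dirichletSeries_div hb hAb hA).symm
    (fun hFG s hs => congrArg (· / poleFactor b A s) (eqOn_shiftedSide hFG hs))
    (fun hFL hmer s hs =>
      (meromorphicOn_shiftedSide hb hAb (hL.congr hFL) hmer s hs).div (hfactor s))
  exact ⟨K, hK, fun s hs => hKL hs ▸ hasSum_dirichletSeries hb hAb hA hs⟩

theorem IsMeromorphicContinuation.eqOn_dirichletSeries (hb : 1 < b) (hAb : ∀ a ∈ A, a < b)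
    (hA : A.Nonempty) {K : ℂ → ℂ} (hK : IsMeromorphicContinuation b A K) :
    Set.EqOn K (dirichletSeries b A) {s | Real.logb b A.card < s.re} := fun s hs =>
  (hK.2 s hs).unique (hasSum_dirichletSeries hb hAb hA hs)

theorem tendsto_blockSum (hb : 1 < b) (hAb : ∀ a ∈ A, a < b) (hA : A.Nonempty) {s : ℂ}
    (hs : Real.logb b A.card - 1 < s.re) (hpole : poleFactor b A s = 0) :
    Tendsto (fun l => blockSum b A l s) atTop
      (𝓝 (shiftedSide b A (dirichletSeries b A) s)) := by
  have htelescope (l : ℕ) : blockSum b A (l + 1) s =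
      blockSum b A 1 s + ∑ i ∈ Finset.range l, ∑ m ∈ block b A (i + 1), digitError b A s m := by
    induction l with
    | zero => simp
    | succ l ih =>
      rw [blockSum_add_two hb hAb, ← sub_eq_zero.1 hpole, one_mul, ih, Finset.sum_range_succ,
        add_assoc]
  rw [← tendsto_add_atTop_iff_nat 1]
  have herror := (hasSum_sum_block hb (hasSum_digitError hb hAb hA hs)).tendsto_sum_nat
  exact (herror.const_add _).congr fun l => (htelescope l).symm

theorem poleZero_re (k : ℤ) : (poleZero b A k).re = Real.logb b A.card := by
  have him : 2 * Real.pi * Complex.I * k / (Real.log b : ℂ) =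
      ((2 * Real.pi * k / Real.log b : ℝ) : ℂ) * Complex.I := by
    push_cast
    ring
  rw [poleZero, him, Complex.add_re, Complex.ofReal_re, Complex.re_ofReal_mul, Complex.I_re,
    mul_zero, add_zero]

theorem natCast_cpow_poleZero (hb : 1 < b) (hA : A.Nonempty) (k : ℤ) :
    (b : ℂ) ^ poleZero b A k = A.card := by
  have hlog : (Real.log b : ℂ) ≠ 0 := by
    exact_mod_cast (Real.log_pos (by exact_mod_cast hb)).ne'
  have hexponent : (Real.log b : ℂ) * poleZero b A k =
      Real.log A.card + k * (2 * Real.pi * Complex.I) := by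
    rw [poleZero, Real.logb, Complex.ofReal_div]
    field_simp
  rw [Complex.cpow_def_of_ne_zero (Nat.cast_ne_zero.2 (by positivity)), ← Complex.natCast_log,
    hexponent, Complex.exp_add, Complex.exp_int_mul_two_pi_mul_I, mul_one, Complex.natCast_log,
    Complex.exp_log (Nat.cast_ne_zero.2 hA.card_ne_zero)]

theorem poleFactor_poleZero (hb : 1 < b) (hA : A.Nonempty) (k : ℤ) :
    poleFactor b A (poleZero b A k) = 0 := by
  rw [poleFactor, Complex.cpow_neg, natCast_cpow_poleZero hb hA,
    mul_inv_cancel₀ (Nat.cast_ne_zero.2 hA.card_ne_zero), sub_self]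

theorem deriv_poleFactor (hb : b ≠ 0) (s : ℂ) :
    deriv (poleFactor b A) s = Real.log b * (1 - poleFactor b A s) := by
  have h := (((hasDerivAt_neg s).const_cpow (c := (b : ℂ))
    (.inl (Nat.cast_ne_zero.2 hb))).const_mul (A.card : ℂ)).const_sub 1
  refine (HasDerivAt.deriv (f := poleFactor b A) h).trans ?_
  rw [poleFactor, ← Complex.natCast_log]
  ring

theorem hasResidueAt_poleZero (hb : 1 < b) (hAb : ∀ a ∈ A, a < b) (hA : A.Nonempty) {K : ℂ → ℂ}
    (hK : IsMeromorphicContinuation b A K) (k : ℤ) :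
    HasResidueAt K (poleZero b A k)
      ((Real.log b : ℂ)⁻¹ * shiftedSide b A (dirichletSeries b A) (poleZero b A k)) := by
  have hb0 : b ≠ 0 := by positivity
  have hlog : (Real.log b : ℂ) ≠ 0 := by
    exact_mod_cast (Real.log_pos (by exact_mod_cast hb)).ne'
  have hside : AnalyticAt ℂ (shiftedSide b A (dirichletSeries b A)) (poleZero b A k) :=
    analyticAt_shiftedSide hb hAb (holomorphicBoundedRightOf_dirichletSeries hb hAb hA) <| by
      simp [poleZero_re]
  have hfactor := (differentiable_poleFactor (A := A) hb0).analyticAt (poleZero b A k)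
  have hzero := poleFactor_poleZero hb hA k
  have hderiv : deriv (poleFactor b A) (poleZero b A k) = Real.log b := by
    rw [deriv_poleFactor hb0, hzero, sub_zero, mul_one]
  rw [← hderiv]
  refine hasResidueAt_of_eventuallyEq_div hside hfactor hzero (hderiv ▸ hlog) <|
    eventuallyEq_of_eqOn_re_gt (hK.1 _) (hside.meromorphicAt.div hfactor.meromorphicAt) ?_
  intro s hs
  have hs' : Real.logb b A.card < s.re := (poleZero_re k).symm.trans_lt hs
  exact (hK.eqOn_dirichletSeries hb hAb hA hs').trans (eqOn_dirichletSeries_div hb hAb hA hs')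

end Continuation

end RestrictedDirichlet

theorem mainTheorem6 (b : ℕ) (hb : 1 < b) (A : Finset ℕ) (hAb : ∀ a ∈ A, a < b)
    (hA : ∃ a ∈ A, a ≠ 0) :
    (∃ K : ℂ → ℂ, RestrictedDirichlet.IsMeromorphicContinuation b A K) ∧
    ∀ K : ℂ → ℂ, RestrictedDirichlet.IsMeromorphicContinuation b A K →
      ∀ k : ℤ, ∃ L : ℂ,
        Tendsto (fun l : ℕ => ∑ n ∈ RestrictedDirichlet.block b A l,
          (n : ℂ) ^ (-RestrictedDirichlet.poleZero b A k)) atTop (𝓝 L) ∧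
        RestrictedDirichlet.HasResidueAt K (RestrictedDirichlet.poleZero b A k)
          ((Real.log b : ℂ)⁻¹ * L) := by
  have hA' : A.Nonempty := hA.imp fun _ h => h.1
  refine ⟨RestrictedDirichlet.exists_isMeromorphicContinuation hb hAb hA', fun K hK k =>
    ⟨_, ?_, RestrictedDirichlet.hasResidueAt_poleZero hb hAb hA' hK k⟩⟩
  have hre : Real.logb b A.card - 1 < (RestrictedDirichlet.poleZero b A k).re := by
    rw [RestrictedDirichlet.poleZero_re]
    exact sub_one_lt _
  exact RestrictedDirichlet.tendsto_blockSum hb hAb hA' hre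
    (RestrictedDirichlet.poleFactor_poleZero hb hA' k)
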